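/- Let $q$ be a real number with $0<q<1$. All algebras are unital complex $*$-algebras, all tensor products are over $\mathbb{C}$, and $A\otimes B$ carries the involution $(a\otimes b)^*=a^*\otimes b^*$. For an integer $n\ge 1$ let $\mathcal{O}(S^{2n+1}_q)$ be the universal unital $*$-algebra with generators $z_0,\dots,z_n$ and relations $$z_iz_j=qz_jz_i\ (i<j),\qquad z_iz_j^*=qz_j^*z_i\ (i\ne j),$$ $$z_iz_i^*=z_i^*z_i+(q^{-2}-1)\sum_{m=i+1}^n z_mz_m^*\ (0\le i\le n),\qquad \sum_{m=0}^n z_mz_m^*=1,$$ and let $\mathcal{O}(S^{2n}_q)$ be the universal unital $*$-algebra with the same generators and relations together with $z_n^*=z_n$. Let $\mathcal{O}(\mathbb{Z}_2)$ be the Hopf $*$-algebra with basis $1,u$, where $u$ is grouplike and self-adjoint with $u^2=1$. Let $\mathcal{O}(U(1))=\mathbb{C}[v,v^{-1}]$ be the Hopf $*$-algebra of Laurent polynomials in a grouplike unitary $v$ (so $v^*=v^{-1}$). Let $\pi_2:\mathcal{O}(U(1))\to\mathcal{O}(\mathbb{Z}_2)$ be the Hopf algebra map with $v\mapsto u$.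 For $A=\mathcal{O}(S^{m}_q)$ let $\rho:A\to A\otimes\mathcal{O}(\mathbb{Z}_2)$ be the $*$-algebra map with $\rho(z_i)=z_i\otimes u$, and put $$A\,\square_{\mathcal{O}(\mathbb{Z}_2)}\,\mathcal{O}(U(1))=\{x\in A\otimes\mathcal{O}(U(1)) : (\rho\otimes\mathrm{id})(x)=(\mathrm{id}\otimes(\pi_2\otimes\mathrm{id})\Delta)(x)\},$$ where $\Delta$ is the coproduct of $\mathcal{O}(U(1))$; this is a unital $*$-subalgebra of $A\otimes\mathcal{O}(U(1))$. (1) For every integer $n\ge 1$, $\mathcal{O}(S^{2n+1}_q)\,\square_{\mathcal{O}(\mathbb{Z}_2)}\,\mathcal{O}(U(1))$ is isomorphic, as an algebra, to $\mathcal{O}(S^{2n+1}_q)\otimes\mathcal{O}(U(1))$. (2) For every integer $n>1$, the $*$-subalgebra $\mathcal{O}(S^{2n}_q)\,\square_{\mathcal{O}(\mathbb{Z}_2)}\,\mathcal{O}(U(1))$ of $\mathcal{O}(S^{2n}_q)\otimes\mathcal{O}(U(1))$ is isomorphic, as a $*$-algebra, to the universal unital $*$-algebra $\mathcal{A}^{2n}$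 with generators $\zeta_0,\dots,\zeta_n$ and a central unitary $\xi$, subject to the relations $$\zeta_i\zeta_j=q\zeta_j\zeta_i\ (i<j),\qquad \zeta_i\zeta_j^*=q\zeta_j^*\zeta_i\ (i\ne j),$$ $$\zeta_i\zeta_i^*=\zeta_i^*\zeta_i+(q^{-2}-1)\sum_{m=i+1}^n \zeta_m\zeta_m^*\ (0\le i\le n),\qquad \sum_{m=0}^n \zeta_m\zeta_m^*=1,\qquad \zeta_n^*=\zeta_n\xi.$$ -/

import Mathlib

open scoped TensorProduct LaurentPolynomial

noncomputable section

namespace QSphere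

/-! ### Free unital complex star-algebras -/

/-- The free unital complex star-algebra on a set `X`: the free algebra on symbols `x` and `x*`,
one pair for every `x` in `X`. The first summand of `X ⊕ X` holds the generators, the second one
their adjoints. (A type synonym, because the free algebra itself carries another star.) -/
def FreeStarAlgebra (X : Type) : Type := FreeAlgebra ℂ (X ⊕ X)

namespace FreeStarAlgebra

variable {X : Type}

instance : Ring (FreeStarAlgebra X) := inferInstanceAs (Ring (FreeAlgebra ℂ (X ⊕ X)))

instance : Algebra ℂ (FreeStarAlgebra X) := inferInstanceAs (Algebra ℂ (FreeAlgebra ℂ (X ⊕ X)))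

/-- The symbols: `inl x` is the generator `x`, `inr x` is its adjoint. -/
def sym (s : X ⊕ X) : FreeStarAlgebra X := FreeAlgebra.ι ℂ s

/-- The generators. -/
def of (x : X) : FreeStarAlgebra X := sym (Sum.inl x)

/-- A ring homomorphism out of the free star-algebra, from its values on scalars and symbols. -/
def liftRing {B : Type*} [Ring B] (c : ℂ →+* B) (hc : ∀ a b, c a * b = b * c a) (g : X ⊕ X → B) :
    FreeStarAlgebra X →+* B :=
  letI : Algebra ℂ B := c.toAlgebra' hc
  (FreeAlgebra.lift ℂ g).toRingHom

theorem liftRing_algebraMap {B : Type*} [Ring B] (c : ℂ →+* B) (hc : ∀ a b, c a * b = b * c a)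
    (g : X ⊕ X → B) (a : ℂ) : liftRing c hc g (algebraMap ℂ (FreeStarAlgebra X) a) = c a :=
  letI : Algebra ℂ B := c.toAlgebra' hc
  (FreeAlgebra.lift ℂ g).commutes a

theorem liftRing_sym {B : Type*} [Ring B] (c : ℂ →+* B) (hc : ∀ a b, c a * b = b * c a)
    (g : X ⊕ X → B) (s : X ⊕ X) : liftRing c hc g (sym s) = g s :=
  letI : Algebra ℂ B := c.toAlgebra' hc
  FreeAlgebra.lift_ι_apply g s

/-- The star as a ring homomorphism to the opposite ring: conjugate-linear, antimultiplicative,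
exchanging each generator with its adjoint. -/
def starHom : FreeStarAlgebra X →+* (FreeStarAlgebra X)ᵐᵒᵖ :=
  liftRing ((algebraMap ℂ (FreeStarAlgebra X)ᵐᵒᵖ).comp (starRingEnd ℂ))
    (fun a b => Algebra.commutes (starRingEnd ℂ a) b) (fun s => MulOpposite.op (sym s.swap))

@[elab_as_elim]
theorem induction {p : FreeStarAlgebra X → Prop}
    (scalar : ∀ a, p (algebraMap ℂ _ a)) (sym : ∀ s, p (sym s))
    (add : ∀ a b, p a → p b → p (a + b)) (mul : ∀ a b, p a → p b → p (a * b))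
    (a : FreeStarAlgebra X) : p a :=
  FreeAlgebra.induction ℂ (X ⊕ X) scalar sym mul add a

instance : StarRing (FreeStarAlgebra X) where
  star a := (starHom a).unop
  star_involutive a := by
    induction a using induction with
    | scalar a =>
      simp only [starHom, liftRing_algebraMap, RingHom.comp_apply, MulOpposite.algebraMap_apply,
        MulOpposite.unop_op, Complex.conj_conj]
    | sym s => simp only [starHom, liftRing_sym, MulOpposite.unop_op, Sum.swap_swap]
    | add a b ha hb => simp only [map_add, MulOpposite.unop_add, ha, hb]
    | mul a b ha hb => simp only [map_mul, MulOpposite.unop_mul, ha, hb]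
  star_mul a b := by simp only [map_mul, MulOpposite.unop_mul]
  star_add a b := by simp only [map_add, MulOpposite.unop_add]

theorem star_algebraMap (a : ℂ) :
    star (algebraMap ℂ (FreeStarAlgebra X) a) = algebraMap ℂ _ (star a) := by
  change (starHom _).unop = _
  simp only [starHom, liftRing_algebraMap]
  rfl

theorem star_sym (s : X ⊕ X) : star (sym s) = sym s.swap := by
  change (starHom _).unop = _
  simp only [starHom, liftRing_sym, MulOpposite.unop_op]

instance : StarModule ℂ (FreeStarAlgebra X) where
  star_smul c a := by
    rw [Algebra.smul_def, star_mul, star_algebraMap, Algebra.smul_def, Algebra.commutes]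

/-- The universal property: a map from `X` to a star-algebra extends to the free star-algebra. -/
def lift {B : Type*} [Ring B] [StarRing B] [Algebra ℂ B] [StarModule ℂ B] (g : X → B) :
    FreeStarAlgebra X →⋆ₐ[ℂ] B where
  toAlgHom :=
    (FreeAlgebra.lift ℂ (Sum.elim g (fun x => star (g x))) : FreeAlgebra ℂ (X ⊕ X) →ₐ[ℂ] B)
  map_star' a := by
    set F : FreeStarAlgebra X →ₐ[ℂ] B :=
      (FreeAlgebra.lift ℂ (Sum.elim g (fun x => star (g x))) : FreeAlgebra ℂ (X ⊕ X) →ₐ[ℂ] B)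
    have hF (s : X ⊕ X) : F (sym s) = Sum.elim g (fun x => star (g x)) s :=
      FreeAlgebra.lift_ι_apply _ _
    change F (star a) = star (F a)
    induction a using induction with
    | scalar a =>
      rw [star_algebraMap, F.commutes, F.commutes, algebraMap_star_comm]
    | sym s => rw [star_sym, hF, hF]; cases s <;> simp
    | add a b ha hb => rw [star_add, map_add, map_add, star_add, ha, hb]
    | mul a b ha hb => rw [star_mul, map_mul, map_mul, star_mul, ha, hb]

theorem lift_of {B : Type*} [Ring B] [StarRing B] [Algebra ℂ B] [StarModule ℂ B] (g : X → B)
    (x : X) : lift g (of x) = g x :=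
  FreeAlgebra.lift_ι_apply (R := ℂ) (Sum.elim g (fun x => star (g x))) (Sum.inl x)

end FreeStarAlgebra

/-! ### Star-algebras given by generators and relations -/

/-- The relations `r` together with their adjoints. -/
def StarClosure {P : Type} [Star P] (r : P → P → Prop) (a b : P) : Prop :=
  r a b ∨ r (star a) (star b)

/-- The universal unital complex star-algebra with generators `X` and relations `a = b` whenever
`r a b`: the quotient of the free star-algebra by the two-sided star-ideal of the relations. -/
def Presented {X : Type} (r : FreeStarAlgebra X → FreeStarAlgebra X → Prop) : Type :=
  RingQuot (StarClosure r)

namespace Presented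

variable {X : Type} {r : FreeStarAlgebra X → FreeStarAlgebra X → Prop}

instance : Ring (Presented r) := inferInstanceAs (Ring (RingQuot (StarClosure r)))

instance : Algebra ℂ (Presented r) := inferInstanceAs (Algebra ℂ (RingQuot (StarClosure r)))

/-- The quotient map. -/
def mkAlg : FreeStarAlgebra X →ₐ[ℂ] Presented r := RingQuot.mkAlgHom ℂ (StarClosure r)

theorem mkAlg_surjective : Function.Surjective (mkAlg (r := r)) :=
  RingQuot.mkAlgHom_surjective ℂ (StarClosure r)

theorem mkAlg_closure {a b : FreeStarAlgebra X} (h : StarClosure r a b) :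
    mkAlg (r := r) a = mkAlg b :=
  RingQuot.mkAlgHom_rel ℂ h

/-- The star on the free star-algebra followed by the quotient map, into the opposite ring. -/
def preStar : FreeStarAlgebra X →+* (Presented r)ᵐᵒᵖ where
  toFun a := MulOpposite.op (mkAlg (star a))
  map_one' := by simp
  map_mul' a b := by simp
  map_zero' := by simp
  map_add' a b := by simp

theorem preStar_closure {a b : FreeStarAlgebra X} (h : StarClosure r a b) :
    preStar (r := r) a = preStar b := by
  refine congrArg MulOpposite.op (mkAlg_closure ?_)
  rcases h with h | h
  · exact Or.inr (by simpa using h)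
  · exact Or.inl h

/-- The star of the quotient as a ring homomorphism to the opposite ring: it sends the class of
`a` to the class of `star a`. -/
def starHom : Presented r →+* (Presented r)ᵐᵒᵖ :=
  RingQuot.lift ⟨preStar, fun _ _ h => preStar_closure h⟩

theorem starHom_mkAlg (a : FreeStarAlgebra X) :
    starHom (r := r) (mkAlg a) = MulOpposite.op (mkAlg (star a)) := by
  have h : mkAlg (r := r) a = RingQuot.mkRingHom (StarClosure r) a := by
    rw [mkAlg, ← RingQuot.mkAlgHom_coe ℂ]
    rfl
  rw [h]
  exact RingQuot.lift_mkRingHom_apply ..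

instance : StarRing (Presented r) where
  star a := (starHom a).unop
  star_involutive a := by
    obtain ⟨a, rfl⟩ := mkAlg_surjective a
    simp only [starHom_mkAlg, MulOpposite.unop_op, star_star]
  star_mul a b := by simp only [map_mul, MulOpposite.unop_mul]
  star_add a b := by simp only [map_add, MulOpposite.unop_add]

theorem mkAlg_star (a : FreeStarAlgebra X) : mkAlg (r := r) (star a) = star (mkAlg a) := by
  change _ = (starHom _).unop
  rw [starHom_mkAlg, MulOpposite.unop_op]

theorem mkAlg_rel {a b : FreeStarAlgebra X} (h : r a b) : mkAlg (r := r) a = mkAlg b :=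
  mkAlg_closure (Or.inl h)

instance : StarModule ℂ (Presented r) where
  star_smul c a := by
    obtain ⟨a, rfl⟩ := mkAlg_surjective a
    rw [← map_smul, ← mkAlg_star, star_smul, map_smul, mkAlg_star]

/-- The generators. -/
def gen (x : X) : Presented r := mkAlg (FreeStarAlgebra.of x)

/-- The universal property. -/
def lift {B : Type*} [Ring B] [StarRing B] [Algebra ℂ B] [StarModule ℂ B] (g : X → B)
    (h : ∀ a b, r a b → FreeStarAlgebra.lift g a = FreeStarAlgebra.lift g b) :
    Presented r →⋆ₐ[ℂ] B where
  toAlgHom := RingQuot.liftAlgHom ℂ (s := StarClosure r) ⟨(FreeStarAlgebra.lift g).toAlgHom, by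
    rintro a b (hab | hab)
    · exact h a b hab
    · apply star_injective
      have := h _ _ hab
      rw [map_star, map_star] at this
      exact this⟩
  map_star' a := by
    obtain ⟨a, rfl⟩ := mkAlg_surjective a
    rw [← mkAlg_star]
    change RingQuot.liftAlgHom ℂ _ (RingQuot.mkAlgHom ℂ _ (star a)) =
      star (RingQuot.liftAlgHom ℂ _ (RingQuot.mkAlgHom ℂ _ a))
    rw [RingQuot.liftAlgHom_mkAlgHom_apply, RingQuot.liftAlgHom_mkAlgHom_apply]
    exact map_star (FreeStarAlgebra.lift g) a

theorem lift_mkAlg {B : Type*} [Ring B] [StarRing B] [Algebra ℂ B] [StarModule ℂ B] (g : X → B)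
    (h : ∀ a b, r a b → FreeStarAlgebra.lift g a = FreeStarAlgebra.lift g b)
    (a : FreeStarAlgebra X) : lift g h (mkAlg a) = FreeStarAlgebra.lift g a :=
  RingQuot.liftAlgHom_mkAlgHom_apply ..

theorem lift_gen {B : Type*} [Ring B] [StarRing B] [Algebra ℂ B] [StarModule ℂ B] (g : X → B)
    (h : ∀ a b, r a b → FreeStarAlgebra.lift g a = FreeStarAlgebra.lift g b) (x : X) :
    lift g h (gen x) = g x := by
  rw [gen, lift_mkAlg, FreeStarAlgebra.lift_of]

end Presented

/-! ### Quantum spheres -/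

/-- The relations of the odd-dimensional quantum sphere, imposed on elements `z 0, …, z n` of a
star-algebra. -/
inductive SphereRel {P : Type} [Ring P] [StarRing P] [Algebra ℂ P] (q : ℝ) {n : ℕ}
    (z : Fin (n + 1) → P) : P → P → Prop
  | comm (i j : Fin (n + 1)) (h : i < j) : SphereRel q z (z i * z j) ((q : ℂ) • (z j * z i))
  | comm_star (i j : Fin (n + 1)) (h : i ≠ j) :
      SphereRel q z (z i * star (z j)) ((q : ℂ) • (star (z j) * z i))
  | self_star (i : Fin (n + 1)) :
      SphereRel q z (z i * star (z i))
        (star (z i) * z i + ((q : ℂ) ^ (-2 : ℤ) - 1) • ∑ m ∈ Finset.Ioi i, z m * star (z m))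
  | radius : SphereRel q z (∑ m, z m * star (z m)) 1

/-- The additional relation `(z n)* = z n` of the even-dimensional quantum sphere. -/
inductive EvenSphereRel {P : Type} [Ring P] [StarRing P] [Algebra ℂ P] (q : ℝ) {n : ℕ}
    (z : Fin (n + 1) → P) : P → P → Prop
  | sphere {a b : P} (h : SphereRel q z a b) : EvenSphereRel q z a b
  | selfAdjoint : EvenSphereRel q z (star (z (Fin.last n))) (z (Fin.last n))

/-- The coordinate algebra of the quantum sphere of dimension `2n+1`. -/
abbrev OddSphere (q : ℝ) (n : ℕ) : Type :=
  Presented (SphereRel q (FreeStarAlgebra.of : Fin (n + 1) → FreeStarAlgebra (Fin (n + 1))))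

/-- The coordinate algebra of the quantum sphere of dimension `2n`. -/
abbrev EvenSphere (q : ℝ) (n : ℕ) : Type :=
  Presented (EvenSphereRel q (FreeStarAlgebra.of : Fin (n + 1) → FreeStarAlgebra (Fin (n + 1))))

/-! ### The Hopf star-algebras of `ℤ₂` and `U(1)` -/

/-- The star on a complex group algebra for which the group elements are unitary. -/
instance groupAlgebraStarRing (G : Type) [AddCommGroup G] : StarRing (AddMonoidAlgebra ℂ G) where
  star a := (AddMonoidAlgebra.mapRingHom G (starRingEnd ℂ))
    (AddMonoidAlgebra.mapDomainRingHom ℂ (negAddMonoidHom : G →+ G) a)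
  star_involutive a := by
    induction a using AddMonoidAlgebra.induction_linear with
    | zero => simp
    | add a b ha hb => simp only [map_add, ha, hb]
    | single g a => simp
  star_mul a b := by rw [mul_comm a b, map_mul, map_mul]
  star_add a b := by rw [map_add, map_add]

theorem star_single {G : Type} [AddCommGroup G] (g : G) (a : ℂ) :
    star (AddMonoidAlgebra.single g a) = AddMonoidAlgebra.single (-g) (star a) := by
  change (AddMonoidAlgebra.mapRingHom G (starRingEnd ℂ))
    (AddMonoidAlgebra.mapDomainRingHom ℂ (negAddMonoidHom : G →+ G) _) = _
  simp

instance (G : Type) [AddCommGroup G] : StarModule ℂ (AddMonoidAlgebra ℂ G) where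
  star_smul c a := by
    induction a using AddMonoidAlgebra.induction_linear with
    | zero => simp
    | add a b ha hb => simp only [smul_add, star_add, ha, hb]
    | single g a => simp [star_single, AddMonoidAlgebra.smul_single]

/-- The Hopf algebra of `ℤ₂`: the complex group algebra of the two-element group, spanned by `1`
and a self-adjoint grouplike element `u` with `u² = 1`. -/
abbrev OZ2 : Type := AddMonoidAlgebra ℂ (ZMod 2)

/-- The grouplike generator of the Hopf algebra of `ℤ₂`. -/
def u : OZ2 := AddMonoidAlgebra.single 1 1

theorem star_u : star u = u := by
  rw [u, star_single, star_one]
  rfl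

theorem u_mul_u : u * u = 1 := by
  rw [u, AddMonoidAlgebra.single_mul_single, mul_one]
  rfl

/-- The Hopf algebra of `U(1)`: Laurent polynomials in the grouplike unitary `v = T 1`. -/
abbrev OU1 : Type := ℂ[T;T⁻¹]

/-- The Hopf algebra map from the Hopf algebra of `U(1)` to that of `ℤ₂`, sending `v` to `u`. -/
def piTwo : OU1 →ₐc[ℂ] OZ2 := AddMonoidAlgebra.mapDomainBialgHom ℂ (Int.castAddHom (ZMod 2))

theorem piTwo_single (k : ℤ) (a : ℂ) :
    piTwo (AddMonoidAlgebra.single k a) = AddMonoidAlgebra.single (k : ZMod 2) a :=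
  AddMonoidAlgebra.mapDomainBialgHom_single _ _ _

/-- The left coaction of the Hopf algebra of `ℤ₂` on that of `U(1)`: the coproduct followed by
`piTwo` on the left leg. -/
def leftCoaction : OU1 →⋆ₐ[ℂ] OZ2 ⊗[ℂ] OU1 where
  toAlgHom := (Algebra.TensorProduct.map (piTwo : OU1 →ₐ[ℂ] OZ2) (AlgHom.id ℂ OU1)).comp
    (Bialgebra.comulAlgHom ℂ OU1)
  map_star' a := by
    set F : OU1 →ₐ[ℂ] OZ2 ⊗[ℂ] OU1 :=
      (Algebra.TensorProduct.map (piTwo : OU1 →ₐ[ℂ] OZ2) (AlgHom.id ℂ OU1)).comp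
        (Bialgebra.comulAlgHom ℂ OU1)
    change F (star a) = star (F a)
    have hF (k : ℤ) (c : ℂ) : F (AddMonoidAlgebra.single k c) =
        AddMonoidAlgebra.single (k : ZMod 2) 1 ⊗ₜ AddMonoidAlgebra.single k c := by
      change Algebra.TensorProduct.map (piTwo : OU1 →ₐ[ℂ] OZ2) (AlgHom.id ℂ OU1)
        (CoalgebraStruct.comul (AddMonoidAlgebra.single k c)) = _
      rw [AddMonoidAlgebra.comul_single]
      simp only [CommSemiring.comul_apply, TensorProduct.map_tmul, AddMonoidAlgebra.lsingle_apply,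
        Algebra.TensorProduct.map_tmul, AlgHom.coe_id, id_eq]
      exact congrArg (· ⊗ₜ[ℂ] (AddMonoidAlgebra.single k c : OU1)) (piTwo_single k 1)
    induction a using AddMonoidAlgebra.induction_linear with
    | zero => simp
    | add a b ha hb => simp only [map_add, star_add, ha, hb]
    | single g a => rw [star_single, hF, hF, TensorProduct.star_tmul, star_single, star_single, Int.cast_neg,
        star_one]

/-! ### Coactions on the quantum spheres -/

theorem SphereRel.map {P : Type} [Ring P] [StarRing P] [Algebra ℂ P]
    {B : Type} [Ring B] [StarRing B] [Algebra ℂ B]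
    {q : ℝ} {n : ℕ} {z : Fin (n + 1) → P} {a b : P} (h : SphereRel q z a b) (f : P →⋆ₐ[ℂ] B) :
    SphereRel q (fun i => f (z i)) (f a) (f b) := by
  cases h with
  | comm i j h => rw [map_mul, map_smul, map_mul]; exact .comm i j h
  | comm_star i j h => rw [map_mul, map_smul, map_mul, map_star]; exact .comm_star i j h
  | self_star i =>
    simp only [map_add, map_mul, map_smul, map_sum, map_star]
    exact .self_star (z := fun i => f (z i)) i
  | radius =>
    simp only [map_mul, map_sum, map_star, map_one]
    exact .radius

/-- If elements `z i` satisfy the sphere relations, then so do the elements `z i ⊗ u`. -/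
theorem SphereRel.tmul_u {A : Type} [Ring A] [StarRing A] [Algebra ℂ A] [StarModule ℂ A]
    {q : ℝ} {n : ℕ} {z : Fin (n + 1) → A} (hz : ∀ a b, SphereRel q z a b → a = b)
    {a b : A ⊗[ℂ] OZ2} (h : SphereRel q (fun i => z i ⊗ₜ[ℂ] u) a b) : a = b := by
  cases h with
  | comm i j h =>
    simp only [Algebra.TensorProduct.tmul_mul_tmul, u_mul_u, TensorProduct.smul_tmul',
      hz _ _ (.comm i j h)]
  | comm_star i j h =>
    simp only [TensorProduct.star_tmul, star_u, Algebra.TensorProduct.tmul_mul_tmul, u_mul_u,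
      TensorProduct.smul_tmul', hz _ _ (.comm_star i j h)]
  | self_star i =>
    simp only [TensorProduct.star_tmul, star_u, Algebra.TensorProduct.tmul_mul_tmul, u_mul_u,
      TensorProduct.smul_tmul', ← TensorProduct.sum_tmul, ← TensorProduct.add_tmul,
      hz _ _ (.self_star i)]
  | radius =>
    simp only [TensorProduct.star_tmul, star_u, Algebra.TensorProduct.tmul_mul_tmul, u_mul_u,
      ← TensorProduct.sum_tmul, hz _ _ .radius, Algebra.TensorProduct.one_def]

/-- If the sphere relations are among the defining ones, they hold for the images of the
elements. -/
theorem SphereRel.of_presented {X : Type} {r : FreeStarAlgebra X → FreeStarAlgebra X → Prop}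
    {q : ℝ} {n : ℕ} {z : Fin (n + 1) → FreeStarAlgebra X} (hr : ∀ a b, SphereRel q z a b → r a b)
    (a b : Presented r) (h : SphereRel q (fun i => Presented.mkAlg (r := r) (z i)) a b) :
    a = b := by
  cases h with
  | comm i j h =>
    simpa only [map_mul, map_smul] using Presented.mkAlg_rel (hr _ _ (SphereRel.comm i j h))
  | comm_star i j h =>
    simpa only [map_mul, map_smul, Presented.mkAlg_star] using
      Presented.mkAlg_rel (hr _ _ (SphereRel.comm_star i j h))
  | self_star i =>
    simpa only [map_mul, map_smul, map_add, map_sum, Presented.mkAlg_star] using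
      Presented.mkAlg_rel (hr _ _ (SphereRel.self_star i))
  | radius =>
    simpa only [map_mul, map_sum, map_one, Presented.mkAlg_star] using
      Presented.mkAlg_rel (hr _ _ SphereRel.radius)

theorem OddSphere.rel {q : ℝ} {n : ℕ} (a b : OddSphere q n)
    (h : SphereRel q (Presented.gen : Fin (n + 1) → OddSphere q n) a b) : a = b :=
  SphereRel.of_presented (fun _ _ h => h) a b h

theorem EvenSphere.rel {q : ℝ} {n : ℕ} (a b : EvenSphere q n)
    (h : SphereRel q (Presented.gen : Fin (n + 1) → EvenSphere q n) a b) : a = b :=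
  SphereRel.of_presented (fun _ _ h => EvenSphereRel.sphere h) a b h

theorem EvenSphere.selfAdjoint (q : ℝ) (n : ℕ) :
    star (Presented.gen (Fin.last n) : EvenSphere q n) = Presented.gen (Fin.last n) := by
  have h := Presented.mkAlg_rel (EvenSphereRel.selfAdjoint
    (q := q) (z := (FreeStarAlgebra.of : Fin (n + 1) → FreeStarAlgebra (Fin (n + 1)))))
  rwa [Presented.mkAlg_star] at h

/-- The right coaction `z i ↦ z i ⊗ u` on the odd-dimensional quantum sphere. -/
def oddCoaction (q : ℝ) (n : ℕ) : OddSphere q n →⋆ₐ[ℂ] OddSphere q n ⊗[ℂ] OZ2 :=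
  Presented.lift (fun i => Presented.gen i ⊗ₜ[ℂ] u) (fun a b h => by
    have h' := h.map (FreeStarAlgebra.lift (fun i => (Presented.gen i : OddSphere q n) ⊗ₜ[ℂ] u))
    simp only [FreeStarAlgebra.lift_of] at h'
    exact SphereRel.tmul_u OddSphere.rel h')

/-- The right coaction `z i ↦ z i ⊗ u` on the even-dimensional quantum sphere. -/
def evenCoaction (q : ℝ) (n : ℕ) : EvenSphere q n →⋆ₐ[ℂ] EvenSphere q n ⊗[ℂ] OZ2 :=
  Presented.lift (fun i => Presented.gen i ⊗ₜ[ℂ] u) (fun a b h => by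
    cases h with
    | sphere h =>
      have h' := h.map (FreeStarAlgebra.lift (fun i => (Presented.gen i : EvenSphere q n) ⊗ₜ[ℂ] u))
      simp only [FreeStarAlgebra.lift_of] at h'
      exact SphereRel.tmul_u EvenSphere.rel h'
    | selfAdjoint =>
      rw [map_star, FreeStarAlgebra.lift_of, TensorProduct.star_tmul, star_u,
        EvenSphere.selfAdjoint])

/-! ### Cotensor products and prolongations -/

/-- The cotensor product of a right comodule star-algebra `A` (coaction `ρ`) and a left comodule
star-algebra `H` (coaction `lam`) over `C`: the equalizer of `ρ ⊗ id` and `id ⊗ lam`, a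
star-subalgebra of `A ⊗ H`. -/
def cotensor {A C H : Type} [Ring A] [StarRing A] [Algebra ℂ A] [StarModule ℂ A]
    [Ring C] [StarRing C] [Algebra ℂ C] [StarModule ℂ C]
    [Ring H] [StarRing H] [Algebra ℂ H] [StarModule ℂ H]
    (ρ : A →⋆ₐ[ℂ] A ⊗[ℂ] C) (lam : H →⋆ₐ[ℂ] C ⊗[ℂ] H) : StarSubalgebra ℂ (A ⊗[ℂ] H) where
  toSubalgebra := AlgHom.equalizer
    ((Algebra.TensorProduct.assoc ℂ ℂ ℂ A C H).toAlgHom.comp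
      (Algebra.TensorProduct.map ρ.toAlgHom (AlgHom.id ℂ H)))
    (Algebra.TensorProduct.map (AlgHom.id ℂ A) lam.toAlgHom)
  star_mem' := by
    intro x hx
    have h1 (x : A ⊗[ℂ] H) : Algebra.TensorProduct.map ρ.toAlgHom (AlgHom.id ℂ H) (star x) =
        star (Algebra.TensorProduct.map ρ.toAlgHom (AlgHom.id ℂ H) x) := by
      induction x with
      | zero => simp
      | add a b ha hb => simp only [map_add, star_add, ha, hb]
      | tmul a b => simpa using congrArg (· ⊗ₜ[ℂ] star b) (map_star ρ a)
    have h2 (x : A ⊗[ℂ] H) : Algebra.TensorProduct.map (AlgHom.id ℂ A) lam.toAlgHom (star x) =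
        star (Algebra.TensorProduct.map (AlgHom.id ℂ A) lam.toAlgHom x) := by
      induction x with
      | zero => simp
      | add a b ha hb => simp only [map_add, star_add, ha, hb]
      | tmul a b => simpa using congrArg (star a ⊗ₜ[ℂ] ·) (map_star lam b)
    have h3 (x : (A ⊗[ℂ] C) ⊗[ℂ] H) : Algebra.TensorProduct.assoc ℂ ℂ ℂ A C H (star x) =
        star (Algebra.TensorProduct.assoc ℂ ℂ ℂ A C H x) := by
      induction x with
      | zero => simp
      | add a b ha hb => simp only [map_add, star_add, ha, hb]
      | tmul a b =>
        induction a with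
        | zero => simp
        | add c d hc hd => simp only [TensorProduct.add_tmul, map_add, star_add, hc, hd]
        | tmul c d => simp
    have hx' : Algebra.TensorProduct.assoc ℂ ℂ ℂ A C H
        (Algebra.TensorProduct.map ρ.toAlgHom (AlgHom.id ℂ H) x) =
        Algebra.TensorProduct.map (AlgHom.id ℂ A) lam.toAlgHom x := hx
    change Algebra.TensorProduct.assoc ℂ ℂ ℂ A C H
        (Algebra.TensorProduct.map ρ.toAlgHom (AlgHom.id ℂ H) (star x)) =
        Algebra.TensorProduct.map (AlgHom.id ℂ A) lam.toAlgHom (star x)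
    rw [h1, h2, h3, hx']

/-- The prolongation of the odd-dimensional quantum sphere to `U(1)`. -/
abbrev oddProlongation (q : ℝ) (n : ℕ) : StarSubalgebra ℂ (OddSphere q n ⊗[ℂ] OU1) :=
  cotensor (oddCoaction q n) leftCoaction

/-- The prolongation of the even-dimensional quantum sphere to `U(1)`. -/
abbrev evenProlongation (q : ℝ) (n : ℕ) : StarSubalgebra ℂ (EvenSphere q n ⊗[ℂ] OU1) :=
  cotensor (evenCoaction q n) leftCoaction

/-! ### The star-algebra with generators `ζ 0, …, ζ n` and a central unitary `ξ` -/

/-- The generating symbols. -/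
inductive KleinGen (n : ℕ) : Type
  | zeta (i : Fin (n + 1)) : KleinGen n
  | xi : KleinGen n

/-- The relations: `ξ` is a central unitary, the `ζ i` satisfy the sphere relations, and
`(ζ n)* = (ζ n) ξ`. -/
inductive KleinRel {P : Type} [Ring P] [StarRing P] [Algebra ℂ P] (q : ℝ) {n : ℕ}
    (ζ : Fin (n + 1) → P) (ξ : P) : P → P → Prop
  | sphere {a b : P} (h : SphereRel q ζ a b) : KleinRel q ζ ξ a b
  | star_last : KleinRel q ζ ξ (star (ζ (Fin.last n))) (ζ (Fin.last n) * ξ)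
  | star_mul_self : KleinRel q ζ ξ (star ξ * ξ) 1
  | mul_star_self : KleinRel q ζ ξ (ξ * star ξ) 1
  | central (a : P) : KleinRel q ζ ξ (ξ * a) (a * ξ)

/-- The star-algebra `𝒜²ⁿ` with generators `ζ 0, …, ζ n`, `ξ` and these relations. -/
abbrev KleinAlgebra (q : ℝ) (n : ℕ) : Type :=
  Presented (KleinRel q
    (fun i : Fin (n + 1) => FreeStarAlgebra.of (KleinGen.zeta i))
    (FreeStarAlgebra.of (KleinGen.xi : KleinGen n)))

end QSphere

end

/-!
Let `A` be one of the sphere algebras, with generators `z i`, and let `v` be the generator of `OU1`.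
Inside `A ⊗ OU1` the cotensor product is generated by the elements `z i ⊗ v`, their adjoints and the
central unitaries `1 ⊗ v^(±2)`. Indeed these lie in it, and they generate a subalgebra `S` with
`A ⊗ OU1 = S + S v` (`exists_eq_add_mul`); evaluating the coactions at the sign character of `ℤ₂`
shows that an element `c + d v` of the cotensor product with `c, d ∈ S` has `d = 0`
(`mem_of_mem_cotensor`).

Now let `E` be a star-algebra generated by elements `ζ i` and a central unitary `ξ`, with a
homomorphism `F : E → A ⊗ OU1` sending `ζ i` to `z i ⊗ v` and `ξ` to `1 ⊗ v⁻²`. By the above, `F` maps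
onto the cotensor product. For injectivity, adjoin to `E` a square root `√ξ`, concretely as a
`2 × 2` matrix over `E`. If the elements `ζ i √ξ` satisfy the relations of `A`, then `z i ↦ ζ i √ξ`,
`v ↦ (√ξ)⁻¹` is a homomorphism on `A ⊗ OU1` that restores `ζ i` and `ξ`; so `F` is injective
(`injective_of_sqrt`) and identifies `E` with the cotensor product (`exists_equiv_cotensor`). No
basis of any of these algebras is needed.

The sphere relations are unchanged when all generators are multiplied by the same central unitary
(`SphereRel.eq_of_map_mul`). In odd dimensions this provides all homomorphisms for
`E = A ⊗ OU1`, `ζ i = z i ⊗ 1`, `ξ = 1 ⊗ v⁻¹`. In even dimensions `E` is the `KleinAlgebra`, where the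
relation `(ζ n)* = ζ n ξ` says precisely that `ζ n √ξ` is self-adjoint.
-/

noncomputable section

namespace QSphere

/-! ### Generation and relations -/

/-- A subalgebra of a presented star-algebra that contains the generators and their adjoints is
everything. -/
theorem Presented.mem_of_gen_mem {X : Type} {r : FreeStarAlgebra X → FreeStarAlgebra X → Prop}
    (S : Subalgebra ℂ (Presented r)) (h : ∀ x, gen x ∈ S) (h' : ∀ x, star (gen x) ∈ S)
    (a : Presented r) : a ∈ S := by
  obtain ⟨a, rfl⟩ := Presented.mkAlg_surjective a
  induction a using FreeStarAlgebra.induction with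
  | scalar c => rw [AlgHom.commutes]; exact S.algebraMap_mem c
  | sym s =>
    rcases s with x | x
    · exact h x
    · have hx := h' x
      rwa [gen, ← mkAlg_star, FreeStarAlgebra.of, FreeStarAlgebra.star_sym] at hx
  | add a b ha hb => rw [map_add]; exact S.add_mem ha hb
  | mul a b ha hb => rw [map_mul]; exact S.mul_mem ha hb

/-- The sphere relations survive an algebra homomorphism that respects the adjoints of the
generators, followed by multiplication of all generators by one and the same unitary that commutes
with the image. -/
theorem SphereRel.eq_of_map_mul {P : Type} [Ring P] [StarRing P] [Algebra ℂ P]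
    {B : Type} [Ring B] [StarRing B] [Algebra ℂ B]
    {q : ℝ} {n : ℕ} {z : Fin (n + 1) → P} (hz : ∀ a b, SphereRel q z a b → a = b)
    (f : P →ₐ[ℂ] B) (hf : ∀ i, f (star (z i)) = star (f (z i))) {w : B}
    (hw : ∀ x, Commute w (f x)) (hw1 : w * star w = 1) (hw2 : star w * w = 1)
    {a b : B} (h : SphereRel q (fun i => f (z i) * w) a b) : a = b := by
  have e1 (i j) : f (z i) * w * (f (z j) * w) = f (z i * z j) * (w * w) := by
    rw [map_mul, mul_assoc, ← mul_assoc w, (hw (z j)).eq]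
    simp only [mul_assoc]
  have e2 (i j) : f (z i) * w * star (f (z j) * w) = f (z i * star (z j)) := by
    rw [star_mul, mul_assoc, ← mul_assoc w, hw1, one_mul, map_mul, hf]
  have e3 (i j) : star (f (z j) * w) * (f (z i) * w) = f (star (z j) * z i) := by
    rw [star_mul, ← hf, mul_assoc, ← mul_assoc (f _), ← map_mul, ← (hw _).eq, ← mul_assoc, hw2,
      one_mul]
  cases h with
  | comm i j h => simp only [e1, hz _ _ (.comm i j h), map_smul, smul_mul_assoc]
  | comm_star i j h => simp only [e2, e3, hz _ _ (.comm_star i j h), map_smul]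
  | self_star i =>
    simp only [e2, e3, hz _ _ (.self_star i), map_smul, map_add, map_sum]
  | radius => simp only [e2, ← map_sum, hz _ _ .radius, map_one]

/-! ### Laurent polynomials -/

/-- The power `v ^ k` of the grouplike generator of `OU1`. -/
def vpow (k : ℤ) : OU1 := AddMonoidAlgebra.single k 1

theorem vpow_mul (k l : ℤ) : vpow k * vpow l = vpow (k + l) := by
  rw [vpow, vpow, AddMonoidAlgebra.single_mul_single, mul_one, vpow]

theorem vpow_zero : vpow 0 = 1 := rfl

theorem star_vpow (k : ℤ) : star (vpow k) = vpow (-k) := by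
  rw [vpow, star_single, star_one, vpow]

theorem mem_of_vpow_mem (S : Subalgebra ℂ OU1) (h : vpow 1 ∈ S) (h' : vpow (-1) ∈ S) (f : OU1) :
    f ∈ S := by
  have hk (k : ℤ) : vpow k ∈ S := by
    induction k with
    | zero => exact S.one_mem
    | succ k ih => rw [← vpow_mul]; exact S.mul_mem ih h
    | pred k ih => rw [sub_eq_add_neg, ← vpow_mul]; exact S.mul_mem ih h'
  induction f using AddMonoidAlgebra.induction_linear with
  | zero => exact S.zero_mem
  | add a b ha hb => exact S.add_mem ha hb
  | single k c =>
    have : (AddMonoidAlgebra.single k c : OU1) = c • vpow k := by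
      rw [vpow, AddMonoidAlgebra.smul_single, smul_eq_mul, mul_one]
    rw [this]
    exact S.smul_mem (hk k) c

/-- Evaluation of Laurent polynomials at a unit. -/
def laurentEval {D : Type} [Ring D] [Algebra ℂ D] (x : Dˣ) : OU1 →ₐ[ℂ] D :=
  AddMonoidAlgebra.lift ℂ D ℤ ((Units.coeHom D).comp (zpowersHom Dˣ x))

theorem laurentEval_vpow {D : Type} [Ring D] [Algebra ℂ D] (x : Dˣ) (k : ℤ) :
    laurentEval x (vpow k) = ((x ^ k : Dˣ) : D) := by
  rw [laurentEval, vpow, AddMonoidAlgebra.lift_single, one_smul]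
  rfl

theorem commute_laurentEval {D : Type} [Ring D] [Algebra ℂ D] {x : Dˣ} {d : D}
    (h : Commute d x) (f : OU1) : Commute d (laurentEval x f) := by
  have := mem_of_vpow_mem ((Subalgebra.centralizer ℂ {d}).comap (laurentEval x)) ?_ ?_ f
  · exact Subalgebra.mem_centralizer_iff ℂ |>.1 this d rfl
  · rw [Subalgebra.mem_comap, Subalgebra.mem_centralizer_iff]
    rintro _ rfl
    rw [laurentEval_vpow]
    exact h.units_zpow_right 1
  · rw [Subalgebra.mem_comap, Subalgebra.mem_centralizer_iff]
    rintro _ rfl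
    rw [laurentEval_vpow]
    exact h.units_zpow_right (-1)

theorem leftCoaction_vpow (k : ℤ) :
    leftCoaction (vpow k) = (AddMonoidAlgebra.single (k : ZMod 2) 1 : OZ2) ⊗ₜ[ℂ] vpow k := by
  change Algebra.TensorProduct.map (piTwo : OU1 →ₐ[ℂ] OZ2) (AlgHom.id ℂ OU1)
    (CoalgebraStruct.comul (AddMonoidAlgebra.single k 1)) = _
  rw [AddMonoidAlgebra.comul_single]
  simp only [CommSemiring.comul_apply, TensorProduct.map_tmul, AddMonoidAlgebra.lsingle_apply,
    Algebra.TensorProduct.map_tmul, AlgHom.coe_id, id_eq]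
  exact congrArg (· ⊗ₜ[ℂ] (AddMonoidAlgebra.single k 1 : OU1)) (piTwo_single k 1)

/-! ### The sign character of `ℤ₂` -/

/-- The sign character of `OZ2`, sending `u` to `-1`. -/
def signChar : OZ2 →ₐ[ℂ] ℂ :=
  AddMonoidAlgebra.lift ℂ ℂ (ZMod 2)
    (AddChar.zmodChar 2 (ζ := (-1 : ℂ)) (by norm_num)).toMonoidHom

theorem signChar_u : signChar u = -1 := by
  rw [signChar, u, AddMonoidAlgebra.lift_single, one_smul, AddChar.toMonoidHom_apply, toAdd_ofAdd,
    AddChar.zmodChar_apply, ZMod.val_one, pow_one]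

theorem single_mul_self (k : ZMod 2) :
    (AddMonoidAlgebra.single k 1 : OZ2) * AddMonoidAlgebra.single k 1 = 1 := by
  rw [AddMonoidAlgebra.single_mul_single, mul_one, CharTwo.add_self_eq_zero]
  rfl

section Sign

variable (A : Type) [Ring A] [Algebra ℂ A]

/-- Evaluation of the middle leg of `A ⊗ (OZ2 ⊗ OU1)` at the sign character. -/
def evalSign : A ⊗[ℂ] (OZ2 ⊗[ℂ] OU1) →ₐ[ℂ] A ⊗[ℂ] OU1 :=
  Algebra.TensorProduct.map (AlgHom.id ℂ A)
    ((Algebra.TensorProduct.lid ℂ OU1).toAlgHom.comp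
      (Algebra.TensorProduct.map signChar (AlgHom.id ℂ OU1)))

theorem evalSign_tmul (a : A) (c : OZ2) (f : OU1) :
    evalSign A (a ⊗ₜ (c ⊗ₜ f)) = a ⊗ₜ (signChar c • f) := by
  simp [evalSign]

/-- The coaction of `OZ2` on the right leg of `A ⊗ OU1`, evaluated at the sign character; it sends
`v` to `-v`. -/
def signTwist : A ⊗[ℂ] OU1 →ₐ[ℂ] A ⊗[ℂ] OU1 :=
  (evalSign A).comp (Algebra.TensorProduct.map (AlgHom.id ℂ A) leftCoaction.toAlgHom)

theorem signTwist_vpow (a : A) (k : ℤ) : signTwist A (a ⊗ₜ vpow k) =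
    a ⊗ₜ (signChar (AddMonoidAlgebra.single (k : ZMod 2) 1) • vpow k) := by
  change evalSign A (a ⊗ₜ (leftCoaction (vpow k))) = _
  rw [leftCoaction_vpow, evalSign_tmul]

theorem signTwist_involutive : Function.Involutive (signTwist A) := by
  intro x
  induction x with
  | zero => simp
  | add x y hx hy => simp only [map_add, hx, hy]
  | tmul a f =>
    induction f using AddMonoidAlgebra.induction_linear with
    | zero => simp
    | add f g hf hg => simp only [TensorProduct.tmul_add, map_add, hf, hg]
    | single k c =>
      have : (AddMonoidAlgebra.single k c : OU1) = c • vpow k := by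
        rw [vpow, AddMonoidAlgebra.smul_single, smul_eq_mul, mul_one]
      rw [this, TensorProduct.tmul_smul, map_smul, map_smul, signTwist_vpow,
        TensorProduct.tmul_smul, map_smul, signTwist_vpow, TensorProduct.tmul_smul,
        smul_smul (signChar _), ← map_mul, single_mul_self, map_one, one_smul]

end Sign

/-! ### Elements of the cotensor product -/

theorem mem_cotensor_iff {A C H : Type} [Ring A] [StarRing A] [Algebra ℂ A] [StarModule ℂ A]
    [Ring C] [StarRing C] [Algebra ℂ C] [StarModule ℂ C]
    [Ring H] [StarRing H] [Algebra ℂ H] [StarModule ℂ H]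
    {ρ : A →⋆ₐ[ℂ] A ⊗[ℂ] C} {lam : H →⋆ₐ[ℂ] C ⊗[ℂ] H} {x : A ⊗[ℂ] H} :
    x ∈ cotensor ρ lam ↔ (Algebra.TensorProduct.assoc ℂ ℂ ℂ A C H)
      (Algebra.TensorProduct.map ρ.toAlgHom (AlgHom.id ℂ H) x) =
        Algebra.TensorProduct.map (AlgHom.id ℂ A) lam.toAlgHom x := Iff.rfl

section Cotensor

variable {X : Type} {r : FreeStarAlgebra X → FreeStarAlgebra X → Prop}
  {ρ : Presented r →⋆ₐ[ℂ] Presented r ⊗[ℂ] OZ2}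

theorem gen_tmul_mem_cotensor (hρ : ∀ x, ρ (Presented.gen x) = Presented.gen x ⊗ₜ u) (x : X) :
    (Presented.gen x : Presented r) ⊗ₜ[ℂ] vpow 1 ∈ cotensor ρ leftCoaction := by
  rw [mem_cotensor_iff]
  change Algebra.TensorProduct.assoc ℂ ℂ ℂ _ _ _ (ρ (Presented.gen x) ⊗ₜ vpow 1) =
    Presented.gen x ⊗ₜ leftCoaction (vpow 1)
  rw [hρ, leftCoaction_vpow, Algebra.TensorProduct.assoc_tmul, Int.cast_one]
  rfl

theorem one_tmul_mem_cotensor {k : ℤ} (hk : (k : ZMod 2) = 0) :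
    (1 : Presented r) ⊗ₜ[ℂ] vpow k ∈ cotensor ρ leftCoaction := by
  rw [mem_cotensor_iff]
  change Algebra.TensorProduct.assoc ℂ ℂ ℂ _ _ _ (ρ 1 ⊗ₜ vpow k) =
    1 ⊗ₜ leftCoaction (vpow k)
  rw [leftCoaction_vpow, map_one, Algebra.TensorProduct.one_def,
    Algebra.TensorProduct.assoc_tmul, hk]
  rfl

theorem one_tmul_vpow_comm {A : Type} [Ring A] [Algebra ℂ A] (k : ℤ) (x : A ⊗[ℂ] OU1) :
    Commute ((1 : A) ⊗ₜ[ℂ] vpow k) x := by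
  induction x with
  | zero => exact Commute.zero_right _
  | add x y hx hy => exact hx.add_right hy
  | tmul a f =>
    rw [Commute, SemiconjBy, Algebra.TensorProduct.tmul_mul_tmul,
      Algebra.TensorProduct.tmul_mul_tmul, one_mul, mul_one, mul_comm]

/-- Modulo a subalgebra `S` containing the listed elements, every element is a multiple of `v` by an
element of `S`: the elements `c + d v` form a subalgebra, because `v` is central and `v²` is in
`S`. -/
theorem exists_eq_add_mul (S : Subalgebra ℂ (Presented r ⊗[ℂ] OU1))
    (h1 : ∀ x, Presented.gen x ⊗ₜ vpow 1 ∈ S)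
    (h2 : ∀ x, star (Presented.gen x) ⊗ₜ vpow (-1) ∈ S)
    (h3 : 1 ⊗ₜ vpow 2 ∈ S) (h4 : 1 ⊗ₜ vpow (-2) ∈ S) (x : Presented r ⊗[ℂ] OU1) :
    ∃ c ∈ S, ∃ d ∈ S, x = c + d * (1 ⊗ₜ vpow 1) := by
  have hvv : ((1 : Presented r) ⊗ₜ[ℂ] vpow 1) * (1 ⊗ₜ vpow 1) = 1 ⊗ₜ vpow 2 := by
    rw [Algebra.TensorProduct.tmul_mul_tmul, one_mul, vpow_mul]; rfl
  let T : Subalgebra ℂ (Presented r ⊗[ℂ] OU1) :=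
    { carrier := {x | ∃ c ∈ S, ∃ d ∈ S, x = c + d * (1 ⊗ₜ vpow 1)}
      mul_mem' := by
        rintro _ _ ⟨c, hc, d, hd, rfl⟩ ⟨c', hc', d', hd', rfl⟩
        refine ⟨c * c' + d * d' * (1 ⊗ₜ vpow 2),
          S.add_mem (S.mul_mem hc hc') (S.mul_mem (S.mul_mem hd hd') h3),
          c * d' + d * c', S.add_mem (S.mul_mem hc hd') (S.mul_mem hd hc'), ?_⟩
        have e1 : d * (1 ⊗ₜ vpow 1) * c' = d * c' * (1 ⊗ₜ vpow 1) := by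
          rw [mul_assoc, (one_tmul_vpow_comm 1 c').eq, mul_assoc]
        have e2 : d * (1 ⊗ₜ vpow 1) * (d' * (1 ⊗ₜ vpow 1)) = d * d' * (1 ⊗ₜ vpow 2) := by
          rw [← hvv, mul_assoc, ← mul_assoc _ d', (one_tmul_vpow_comm 1 d').eq]
          simp only [mul_assoc]
        rw [add_mul, mul_add, mul_add, e1, e2, add_mul (c * d'), ← mul_assoc c]
        abel
      add_mem' := by
        rintro _ _ ⟨c, hc, d, hd, rfl⟩ ⟨c', hc', d', hd', rfl⟩
        refine ⟨c + c', S.add_mem hc hc', d + d', S.add_mem hd hd', ?_⟩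
        rw [add_mul]
        abel
      algebraMap_mem' := fun c =>
        ⟨algebraMap ℂ _ c, S.algebraMap_mem c, 0, S.zero_mem, by rw [zero_mul, add_zero]⟩ }
  have hST : ∀ d ∈ S, d * (1 ⊗ₜ vpow 1) ∈ T := fun d hd =>
    ⟨0, S.zero_mem, d, hd, by rw [zero_add]⟩
  have hv (f : OU1) : (1 : Presented r) ⊗ₜ f ∈ T := by
    refine mem_of_vpow_mem (T.comap Algebra.TensorProduct.includeRight) ?_ ?_ f
    · simpa using hST 1 S.one_mem
    · have := hST _ h4
      rwa [Algebra.TensorProduct.tmul_mul_tmul, one_mul, vpow_mul] at this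
  have ha (a : Presented r) : a ⊗ₜ 1 ∈ T := by
    refine Presented.mem_of_gen_mem (T.comap Algebra.TensorProduct.includeLeft) ?_ ?_ a
    · intro x
      have := hST _ (S.mul_mem (h1 x) h4)
      rwa [Algebra.TensorProduct.tmul_mul_tmul, Algebra.TensorProduct.tmul_mul_tmul, mul_one,
        mul_one, vpow_mul, vpow_mul] at this
    · intro x
      have := hST _ (h2 x)
      rwa [Algebra.TensorProduct.tmul_mul_tmul, mul_one, vpow_mul] at this
  change x ∈ T
  induction x with
  | zero => exact T.zero_mem
  | add x y hx hy => exact T.add_mem hx hy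
  | tmul a f => simpa using T.mul_mem (ha a) (hv f)

/-- A subalgebra of the cotensor product that contains the `z x ⊗ v`, their adjoints and the
`1 ⊗ v^(±2)` is the whole cotensor product. It spans everything together with its multiples of `v`,
and the cotensor product contains no nonzero product of `v` with one of its own elements: the two
coactions agree on the cotensor product but differ by a sign on `v`, once the middle leg is
evaluated at the sign character. -/
theorem mem_of_mem_cotensor (S : Subalgebra ℂ (Presented r ⊗[ℂ] OU1))
    (hS : ∀ x ∈ S, x ∈ cotensor ρ leftCoaction)
    (h1 : ∀ x, Presented.gen x ⊗ₜ vpow 1 ∈ S)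
    (h2 : ∀ x, star (Presented.gen x) ⊗ₜ vpow (-1) ∈ S)
    (h3 : 1 ⊗ₜ vpow 2 ∈ S) (h4 : 1 ⊗ₜ vpow (-2) ∈ S) {x : Presented r ⊗[ℂ] OU1}
    (hx : x ∈ cotensor ρ leftCoaction) : x ∈ S := by
  obtain ⟨c, hc, d, hd, rfl⟩ := exists_eq_add_mul S h1 h2 h3 h4 x
  have hdv : d * (1 ⊗ₜ vpow 1) ∈ cotensor ρ leftCoaction := by
    simpa using sub_mem hx (hS c hc)
  let f : Presented r ⊗[ℂ] OU1 →ₐ[ℂ] Presented r ⊗[ℂ] OU1 := (evalSign (Presented r)).comp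
    ((Algebra.TensorProduct.assoc ℂ ℂ ℂ (Presented r) OZ2 OU1).toAlgHom.comp
      (Algebra.TensorProduct.map ρ.toAlgHom (AlgHom.id ℂ OU1)))
  have hf : ∀ y ∈ cotensor ρ leftCoaction, f y = signTwist _ y := fun y hy =>
    congrArg (evalSign (Presented r)) (mem_cotensor_iff.1 hy)
  have hfv : f (1 ⊗ₜ vpow 1) = 1 ⊗ₜ vpow 1 := by
    change evalSign _ (Algebra.TensorProduct.assoc ℂ ℂ ℂ _ _ _ (ρ 1 ⊗ₜ vpow 1)) = _
    rw [map_one, Algebra.TensorProduct.one_def, Algebra.TensorProduct.assoc_tmul, evalSign_tmul,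
      map_one, one_smul]
  have hgv : signTwist (Presented r) (1 ⊗ₜ vpow 1) = (-1 : ℂ) • (1 ⊗ₜ vpow 1) := by
    rw [signTwist_vpow, Int.cast_one, ← u, signChar_u, TensorProduct.tmul_smul]
  have h := hf _ hdv
  rw [map_mul, map_mul, hfv, hgv, hf d (hS d hd), mul_smul_comm] at h
  have h0 : signTwist (Presented r) d * (1 ⊗ₜ vpow 1) = 0 := by
    refine (smul_eq_zero_iff_right (two_ne_zero (α := ℂ))).1 ?_
    rw [show (2 : ℂ) = 1 - -1 by norm_num, sub_smul, ← h, one_smul, sub_self]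
  have h' := congrArg (· * ((1 : Presented r) ⊗ₜ[ℂ] vpow (-1))) h0
  simp only [mul_assoc, Algebra.TensorProduct.tmul_mul_tmul, one_mul, vpow_mul, zero_mul] at h'
  rw [show (1 : ℤ) + -1 = 0 from rfl, vpow_zero, ← Algebra.TensorProduct.one_def, mul_one] at h'
  have hd0 : d = 0 := (signTwist_involutive _).injective (by rw [h', map_zero])
  rw [hd0, zero_mul, add_zero]
  exact hc

end Cotensor

/-! ### Adjoining a square root of a central unitary -/

section SqrtUnit

variable {E : Type} [Ring E]

/-- A square root of `ξ` in the `2 × 2` matrices; it is the matrix of multiplication by `√ξ` in the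
basis `1, √ξ` of `E ⊕ E √ξ`. It is unitary when `ξ` is, and commutes with `E` when `ξ` is
central. -/
def sqrtMatrix (ξ : E) : Matrix (Fin 2) (Fin 2) E := !![0, ξ; 1, 0]

theorem star_sqrtMatrix [StarRing E] (ξ : E) : star (sqrtMatrix ξ) = !![0, 1; star ξ, 0] := by
  ext i j
  fin_cases i <;> fin_cases j <;> simp [sqrtMatrix]

theorem sqrtMatrix_mul_self (ξ : E) :
    sqrtMatrix ξ * sqrtMatrix ξ = Matrix.scalar (Fin 2) ξ := by
  ext i j
  fin_cases i <;> fin_cases j <;> simp [sqrtMatrix, Matrix.mul_apply]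

theorem sqrtMatrix_mul_star [StarRing E] {ξ : E} (h : ξ * star ξ = 1) :
    sqrtMatrix ξ * star (sqrtMatrix ξ) = 1 := by
  rw [star_sqrtMatrix]
  ext i j
  fin_cases i <;> fin_cases j <;> simp [sqrtMatrix, Matrix.mul_apply, h]

theorem star_mul_sqrtMatrix [StarRing E] {ξ : E} (h : star ξ * ξ = 1) :
    star (sqrtMatrix ξ) * sqrtMatrix ξ = 1 := by
  rw [star_sqrtMatrix]
  ext i j
  fin_cases i <;> fin_cases j <;> simp [sqrtMatrix, Matrix.mul_apply, h]

theorem commute_sqrtMatrix {ξ : E} (h : ∀ a, Commute ξ a) (a : E) :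
    Commute (sqrtMatrix ξ) (Matrix.scalar (Fin 2) a) := by
  rw [Commute, SemiconjBy]
  ext i j
  fin_cases i <;> fin_cases j <;> simp [sqrtMatrix, (h a).eq]

theorem star_scalar [StarRing E] (a : E) :
    star (Matrix.scalar (Fin 2) a) = Matrix.scalar (Fin 2) (star a) := by
  ext i j
  fin_cases i <;> fin_cases j <;> simp

end SqrtUnit

/-! ### Recognizing the prolongation -/

section Recognition

variable {X : Type} {r : FreeStarAlgebra X → FreeStarAlgebra X → Prop}
  {ρ : Presented r →⋆ₐ[ℂ] Presented r ⊗[ℂ] OZ2}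
  {E : Type} [Ring E] [StarRing E] [Algebra ℂ E]

/-- If `z x ↦ ζ x * √ξ` defines a homomorphism `Θ`, then the homomorphism `F` with
`F (ζ x) = z x ⊗ v` and `F ξ = 1 ⊗ v⁻²` is injective: `Θ` together with `v⁻¹ ↦ √ξ` is a left
inverse. -/
theorem injective_of_sqrt {ζ : X → E} {ξ : E}
    (hgen : ∀ S : Subalgebra ℂ E, (∀ x, ζ x ∈ S) → (∀ x, star (ζ x) ∈ S) → ξ ∈ S → star ξ ∈ S →
      ∀ a, a ∈ S)
    (hξ : ∀ a, Commute ξ a) (hξ1 : ξ * star ξ = 1) (hξ2 : star ξ * ξ = 1)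
    (F : E →ₐ[ℂ] Presented r ⊗[ℂ] OU1)
    (hF1 : ∀ x, F (ζ x) = Presented.gen x ⊗ₜ vpow 1)
    (hF2 : ∀ x, F (star (ζ x)) = star (Presented.gen x) ⊗ₜ vpow (-1))
    (hF3 : F ξ = 1 ⊗ₜ vpow (-2)) (hF4 : F (star ξ) = 1 ⊗ₜ vpow 2)
    (Θ : Presented r →⋆ₐ[ℂ] Matrix (Fin 2) (Fin 2) E)
    (hΘ : ∀ x, Θ (Presented.gen x) = Matrix.scalar (Fin 2) (ζ x) * sqrtMatrix ξ) :
    Function.Injective F := by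
  have hw1 := sqrtMatrix_mul_star hξ1
  have hw2 := star_mul_sqrtMatrix hξ2
  have hcw := commute_sqrtMatrix hξ
  have hcw' (a : E) : Commute (star (sqrtMatrix ξ)) (Matrix.scalar (Fin 2) a) := by
    rw [← star_star a, ← star_scalar]
    exact (hcw (star a)).star_star
  have hΘ' (x : X) : Θ (star (Presented.gen x)) =
      star (sqrtMatrix ξ) * Matrix.scalar (Fin 2) (star (ζ x)) := by
    rw [map_star, hΘ, star_mul, star_scalar]
  -- The unit `v` goes to the inverse of the square root.
  let y : (Matrix (Fin 2) (Fin 2) E)ˣ := ⟨star (sqrtMatrix ξ), sqrtMatrix ξ, hw2, hw1⟩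
  have hy : Commute (star (sqrtMatrix ξ)) (sqrtMatrix ξ) := by
    rw [Commute, SemiconjBy, hw1, hw2]
  have hcomm (a : Presented r) : Commute (Θ a) (star (sqrtMatrix ξ)) := by
    have := Presented.mem_of_gen_mem
      ((Subalgebra.centralizer ℂ {star (sqrtMatrix ξ)}).comap Θ.toAlgHom) ?_ ?_ a
    · exact (Subalgebra.mem_centralizer_iff ℂ |>.1 this _ rfl).symm
    · intro x
      rw [Subalgebra.mem_comap, Subalgebra.mem_centralizer_iff]
      rintro _ rfl
      change _ * Θ _ = Θ _ * _
      rw [hΘ]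
      exact (hcw' _).mul_right hy
    · intro x
      rw [Subalgebra.mem_comap, Subalgebra.mem_centralizer_iff]
      rintro _ rfl
      change _ * Θ _ = Θ _ * _
      rw [hΘ']
      exact (Commute.refl _).mul_right (hcw' _)
  let Ψ : Presented r ⊗[ℂ] OU1 →ₐ[ℂ] Matrix (Fin 2) (Fin 2) E :=
    Algebra.TensorProduct.lift Θ.toAlgHom (laurentEval y)
      (fun a f => commute_laurentEval (hcomm a) f)
  have hΨ (a : Presented r) (k : ℤ) :
      Ψ (a ⊗ₜ vpow k) = Θ a * ((y ^ k : (Matrix (Fin 2) (Fin 2) E)ˣ) : Matrix _ _ E) := by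
    rw [← laurentEval_vpow]
    exact Algebra.TensorProduct.lift_tmul ..
  have hy1 : ((y ^ (1 : ℤ) : (Matrix (Fin 2) (Fin 2) E)ˣ) : Matrix _ _ E) =
    star (sqrtMatrix ξ) := by rw [zpow_one]
  have hy2 : ((y ^ (-1 : ℤ) : (Matrix (Fin 2) (Fin 2) E)ˣ) : Matrix _ _ E) =
    sqrtMatrix ξ := by rw [zpow_neg_one]; rfl
  have hy3 : ((y ^ (2 : ℤ) : (Matrix (Fin 2) (Fin 2) E)ˣ) : Matrix _ _ E) =
      Matrix.scalar (Fin 2) (star ξ) := by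
    rw [show (2 : ℤ) = 1 + 1 from rfl, zpow_add, Units.val_mul, hy1, ← star_mul,
      sqrtMatrix_mul_self, star_scalar]
  have hy4 : ((y ^ (-2 : ℤ) : (Matrix (Fin 2) (Fin 2) E)ˣ) : Matrix _ _ E) =
      Matrix.scalar (Fin 2) ξ := by
    rw [show (-2 : ℤ) = -1 + -1 from rfl, zpow_add, Units.val_mul, hy2, sqrtMatrix_mul_self]
  have key (a : E) : Ψ (F a) = Matrix.scalar (Fin 2) a := by
    refine hgen (AlgHom.equalizer (Ψ.comp F) (Matrix.scalarAlgHom (Fin 2) ℂ)) ?_ ?_ ?_ ?_ a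
    · intro x
      change Ψ (F _) = Matrix.scalar (Fin 2) _
      rw [hF1, hΨ, hΘ, hy1, mul_assoc, hw1, mul_one]
    · intro x
      change Ψ (F _) = Matrix.scalar (Fin 2) _
      rw [hF2, hΨ, hΘ', hy2, mul_assoc, ← (hcw _).eq, ← mul_assoc, hw2, one_mul]
    · change Ψ (F _) = Matrix.scalar (Fin 2) _
      rw [hF3, hΨ, map_one, one_mul, hy4]
    · change Ψ (F _) = Matrix.scalar (Fin 2) _
      rw [hF4, hΨ, map_one, one_mul, hy3]
  intro a b hab
  have h := key a
  rw [hab, key b] at h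
  exact (Matrix.scalar_inj.1 h).symm

/-- A star-algebra generated by elements `ζ x` and a central unitary `ξ` is the prolongation as
soon as `ζ x ↦ z x ⊗ v`, `ξ ↦ 1 ⊗ v⁻²` and `z x ↦ ζ x * √ξ` define homomorphisms. -/
theorem exists_equiv_cotensor (hρ : ∀ x, ρ (Presented.gen x) = Presented.gen x ⊗ₜ u)
    {ζ : X → E} {ξ : E}
    (hgen : ∀ S : Subalgebra ℂ E, (∀ x, ζ x ∈ S) → (∀ x, star (ζ x) ∈ S) → ξ ∈ S → star ξ ∈ S →
      ∀ a, a ∈ S)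
    (hξ : ∀ a, Commute ξ a) (hξ1 : ξ * star ξ = 1) (hξ2 : star ξ * ξ = 1)
    (F : E →ₐ[ℂ] Presented r ⊗[ℂ] OU1)
    (hF1 : ∀ x, F (ζ x) = Presented.gen x ⊗ₜ vpow 1)
    (hF2 : ∀ x, F (star (ζ x)) = star (Presented.gen x) ⊗ₜ vpow (-1))
    (hF3 : F ξ = 1 ⊗ₜ vpow (-2)) (hF4 : F (star ξ) = 1 ⊗ₜ vpow 2)
    (Θ : Presented r →⋆ₐ[ℂ] Matrix (Fin 2) (Fin 2) E)
    (hΘ : ∀ x, Θ (Presented.gen x) = Matrix.scalar (Fin 2) (ζ x) * sqrtMatrix ξ) :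
    ∃ e : E ≃ₐ[ℂ] cotensor ρ leftCoaction, ∀ a, (e a : Presented r ⊗[ℂ] OU1) = F a := by
  have hmem (a : E) : F a ∈ cotensor ρ leftCoaction := by
    refine hgen ((cotensor ρ leftCoaction).toSubalgebra.comap F) ?_ ?_ ?_ ?_ a
    · intro x
      change F _ ∈ cotensor ρ leftCoaction
      rw [hF1]
      exact gen_tmul_mem_cotensor hρ x
    · intro x
      change F _ ∈ cotensor ρ leftCoaction
      rw [hF2, ← star_vpow, ← TensorProduct.star_tmul]
      exact star_mem (gen_tmul_mem_cotensor hρ x)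
    · change F _ ∈ cotensor ρ leftCoaction
      rw [hF3]
      exact one_tmul_mem_cotensor rfl
    · change F _ ∈ cotensor ρ leftCoaction
      rw [hF4]
      exact one_tmul_mem_cotensor rfl
  let F' : E →ₐ[ℂ] cotensor ρ leftCoaction :=
    F.codRestrict (cotensor ρ leftCoaction).toSubalgebra hmem
  have hinj : Function.Injective F' := fun a b hab =>
    injective_of_sqrt hgen hξ hξ1 hξ2 F hF1 hF2 hF3 hF4 Θ hΘ (congrArg Subtype.val hab)
  have hsurj : Function.Surjective F' := by
    rintro ⟨x, hx⟩
    obtain ⟨a, ha⟩ := mem_of_mem_cotensor F.range (by rintro _ ⟨a, rfl⟩; exact hmem a)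
      (fun x => ⟨ζ x, hF1 x⟩) (fun x => ⟨_, hF2 x⟩) ⟨_, hF4⟩ ⟨_, hF3⟩ hx
    exact ⟨a, Subtype.ext ha⟩
  exact ⟨AlgEquiv.ofBijective F' ⟨hinj, hsurj⟩, fun a => rfl⟩

end Recognition

/-! ### Twisted generators satisfying the sphere relations -/

theorem one_tmul_vpow_mul_star {A : Type} [Ring A] [StarRing A] [Algebra ℂ A] [StarModule ℂ A]
    (k : ℤ) : ((1 : A) ⊗ₜ[ℂ] vpow k) * star (1 ⊗ₜ vpow k) = 1 := by
  rw [TensorProduct.star_tmul, star_vpow, Algebra.TensorProduct.tmul_mul_tmul, star_one, one_mul,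
    vpow_mul, add_neg_cancel, vpow_zero, Algebra.TensorProduct.one_def]

theorem one_tmul_vpow_star_mul {A : Type} [Ring A] [StarRing A] [Algebra ℂ A] [StarModule ℂ A]
    (k : ℤ) : star ((1 : A) ⊗ₜ[ℂ] vpow k) * (1 ⊗ₜ vpow k) = 1 := by
  rw [TensorProduct.star_tmul, star_vpow, Algebra.TensorProduct.tmul_mul_tmul, star_one, one_mul,
    vpow_mul, neg_add_cancel, vpow_zero, Algebra.TensorProduct.one_def]

/-- If the `z i` satisfy the sphere relations, then so do the `z i ⊗ v`. -/
theorem SphereRel.eq_of_tmul_vpow {A : Type} [Ring A] [StarRing A] [Algebra ℂ A] [StarModule ℂ A]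
    {q : ℝ} {n : ℕ} {z : Fin (n + 1) → A} (hz : ∀ a b, SphereRel q z a b → a = b)
    {a b : A ⊗[ℂ] OU1} (h : SphereRel q (fun i => z i ⊗ₜ[ℂ] vpow 1) a b) : a = b := by
  refine SphereRel.eq_of_map_mul hz (Algebra.TensorProduct.includeLeft (S := ℂ)) ?_
    (fun x => one_tmul_vpow_comm 1 _) (one_tmul_vpow_mul_star 1) (one_tmul_vpow_star_mul 1) ?_
  · intro i
    simp
  · simpa using h

/-- If the `ζ i` satisfy the sphere relations and `ξ` is a central unitary, then the `ζ i * √ξ`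
satisfy the sphere relations. -/
theorem SphereRel.eq_of_mul_sqrtMatrix {E : Type} [Ring E] [StarRing E] [Algebra ℂ E]
    {q : ℝ} {n : ℕ} {ζ : Fin (n + 1) → E} (hζ : ∀ a b, SphereRel q ζ a b → a = b) {ξ : E}
    (hξ : ∀ a, Commute ξ a) (hξ1 : ξ * star ξ = 1) (hξ2 : star ξ * ξ = 1)
    {a b : Matrix (Fin 2) (Fin 2) E}
    (h : SphereRel q (fun i => Matrix.scalar (Fin 2) (ζ i) * sqrtMatrix ξ) a b) : a = b :=
  SphereRel.eq_of_map_mul hζ (Matrix.scalarAlgHom (Fin 2) ℂ) (fun _ => (star_scalar _).symm)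
    (commute_sqrtMatrix hξ) (sqrtMatrix_mul_star hξ1) (star_mul_sqrtMatrix hξ2) h

/-! ### The odd-dimensional spheres -/

/-- The coaction `z i ↦ z i ⊗ v` of `OU1` on the odd-dimensional quantum sphere. -/
def oddCircleCoaction (q : ℝ) (n : ℕ) : OddSphere q n →⋆ₐ[ℂ] OddSphere q n ⊗[ℂ] OU1 :=
  Presented.lift (fun i => Presented.gen i ⊗ₜ[ℂ] vpow 1) (fun a b h => by
    have h' := h.map
      (FreeStarAlgebra.lift (fun i => (Presented.gen i : OddSphere q n) ⊗ₜ[ℂ] vpow 1))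
    simp only [FreeStarAlgebra.lift_of] at h'
    exact SphereRel.eq_of_tmul_vpow OddSphere.rel h')

theorem oddCircleCoaction_gen (q : ℝ) (n : ℕ) (i : Fin (n + 1)) :
    oddCircleCoaction q n (Presented.gen i) = Presented.gen i ⊗ₜ vpow 1 :=
  Presented.lift_gen ..

/-- The homomorphism `a ⊗ f ↦ ρ(a) (1 ⊗ f(v²))`, where `ρ` is the coaction of `OU1`. -/
def oddToTensor (q : ℝ) (n : ℕ) : OddSphere q n ⊗[ℂ] OU1 →ₐ[ℂ] OddSphere q n ⊗[ℂ] OU1 :=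
  Algebra.TensorProduct.lift (oddCircleCoaction q n).toAlgHom
    (laurentEval ⟨1 ⊗ₜ vpow 2, star (1 ⊗ₜ vpow 2), one_tmul_vpow_mul_star 2,
      one_tmul_vpow_star_mul 2⟩)
    (fun _ _ => commute_laurentEval (one_tmul_vpow_comm 2 _).symm _)

theorem oddToTensor_tmul_one (q : ℝ) (n : ℕ) (a : OddSphere q n) :
    oddToTensor q n (a ⊗ₜ 1) = oddCircleCoaction q n a := by
  rw [oddToTensor, Algebra.TensorProduct.lift_tmul, map_one, mul_one]
  rfl

theorem oddToTensor_one_tmul_one (q : ℝ) (n : ℕ) :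
    oddToTensor q n (1 ⊗ₜ vpow 1) = 1 ⊗ₜ vpow 2 := by
  rw [oddToTensor, Algebra.TensorProduct.lift_tmul, map_one, one_mul, laurentEval_vpow, zpow_one]

theorem oddToTensor_one_tmul_neg_one (q : ℝ) (n : ℕ) :
    oddToTensor q n (1 ⊗ₜ vpow (-1)) = 1 ⊗ₜ vpow (-2) := by
  rw [oddToTensor, Algebra.TensorProduct.lift_tmul, map_one, one_mul, laurentEval_vpow,
    zpow_neg_one]
  change star _ = _
  rw [TensorProduct.star_tmul, star_one, star_vpow]

/-- The prolongation of an odd-dimensional quantum sphere is trivial: since the coaction of `OZ2`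
lifts to one of `OU1`, it is generated by the `z i ⊗ v` and an independent central unitary `v²`. -/
theorem nonempty_oddProlongation_equiv (q : ℝ) (n : ℕ) :
    Nonempty (oddProlongation q n ≃ₐ[ℂ] OddSphere q n ⊗[ℂ] OU1) := by
  have hξ : ∀ a : OddSphere q n ⊗[ℂ] OU1, Commute (1 ⊗ₜ vpow (-1)) a := one_tmul_vpow_comm (-1)
  have hζ : ∀ a b : OddSphere q n ⊗[ℂ] OU1,
      SphereRel q (fun i => Presented.gen i ⊗ₜ[ℂ] (1 : OU1)) a b → a = b := by
    intro a b h
    refine SphereRel.eq_of_map_mul OddSphere.rel (w := 1)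
      (Algebra.TensorProduct.includeLeft (S := ℂ)) ?_ (fun _ => Commute.one_left _) ?_ ?_ ?_
    · intro i
      simp
    · simp
    · simp
    · simpa using h
  obtain ⟨e, -⟩ := exists_equiv_cotensor (ρ := oddCoaction q n)
    (fun _ => Presented.lift_gen ..)
    (ζ := fun i => (Presented.gen i : OddSphere q n) ⊗ₜ[ℂ] (1 : OU1)) (ξ := 1 ⊗ₜ vpow (-1))
    (by
      intro S h1 h2 h3 h4 x
      have ha (a : OddSphere q n) : a ⊗ₜ 1 ∈ S :=
        Presented.mem_of_gen_mem (S.comap Algebra.TensorProduct.includeLeft) h1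
          (fun i => by simpa using h2 i) a
      have hf (f : OU1) : 1 ⊗ₜ f ∈ S :=
        mem_of_vpow_mem (S.comap Algebra.TensorProduct.includeRight)
          (by simpa [TensorProduct.star_tmul, star_vpow] using h4) h3 f
      induction x with
      | zero => exact S.zero_mem
      | add x y hx hy => exact S.add_mem hx hy
      | tmul a f => simpa using S.mul_mem (ha a) (hf f))
    hξ (one_tmul_vpow_mul_star (-1)) (one_tmul_vpow_star_mul (-1)) (oddToTensor q n)
    (fun i => by rw [oddToTensor_tmul_one, oddCircleCoaction_gen])
    (fun i => by
      rw [TensorProduct.star_tmul, star_one, oddToTensor_tmul_one, map_star,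
        oddCircleCoaction_gen, TensorProduct.star_tmul, star_vpow])
    (oddToTensor_one_tmul_neg_one q n)
    (by
      rw [TensorProduct.star_tmul, star_one, star_vpow]
      exact oddToTensor_one_tmul_one q n)
    (Presented.lift (fun i => Matrix.scalar (Fin 2) (Presented.gen i ⊗ₜ[ℂ] (1 : OU1)) *
      sqrtMatrix (1 ⊗ₜ vpow (-1))) (fun a b h => by
        have h' := h.map (FreeStarAlgebra.lift (fun i => Matrix.scalar (Fin 2)
          ((Presented.gen i : OddSphere q n) ⊗ₜ[ℂ] (1 : OU1)) * sqrtMatrix (1 ⊗ₜ vpow (-1))))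
        simp only [FreeStarAlgebra.lift_of] at h'
        exact SphereRel.eq_of_mul_sqrtMatrix hζ hξ (one_tmul_vpow_mul_star (-1))
          (one_tmul_vpow_star_mul (-1)) h'))
    (fun _ => Presented.lift_gen ..)
  exact ⟨e.symm⟩

/-! ### The even-dimensional spheres -/

namespace KleinAlgebra

variable {q : ℝ} {n : ℕ}

/-- The generators `ζ i`. -/
def zeta (i : Fin (n + 1)) : KleinAlgebra q n := Presented.gen (KleinGen.zeta i)

/-- The generator `ξ`. -/
def xi : KleinAlgebra q n := Presented.gen KleinGen.xi

theorem rel (a b : KleinAlgebra q n) (h : SphereRel q zeta a b) : a = b :=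
  SphereRel.of_presented (fun _ _ h => KleinRel.sphere h) a b h

theorem star_zeta_last :
    star (zeta (Fin.last n) : KleinAlgebra q n) = zeta (Fin.last n) * xi := by
  have h := Presented.mkAlg_rel (KleinRel.star_last (q := q)
    (ζ := fun i : Fin (n + 1) => FreeStarAlgebra.of (KleinGen.zeta i))
    (ξ := FreeStarAlgebra.of KleinGen.xi))
  rwa [Presented.mkAlg_star, map_mul] at h

theorem star_xi_mul : star xi * (xi : KleinAlgebra q n) = 1 := by
  have h := Presented.mkAlg_rel (KleinRel.star_mul_self (q := q)
    (ζ := fun i : Fin (n + 1) => FreeStarAlgebra.of (KleinGen.zeta i))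
    (ξ := FreeStarAlgebra.of KleinGen.xi))
  rwa [map_mul, Presented.mkAlg_star, map_one] at h

theorem xi_mul_star : (xi : KleinAlgebra q n) * star xi = 1 := by
  have h := Presented.mkAlg_rel (KleinRel.mul_star_self (q := q)
    (ζ := fun i : Fin (n + 1) => FreeStarAlgebra.of (KleinGen.zeta i))
    (ξ := FreeStarAlgebra.of KleinGen.xi))
  rwa [map_mul, Presented.mkAlg_star, map_one] at h

theorem commute_xi (a : KleinAlgebra q n) : Commute xi a := by
  obtain ⟨a, rfl⟩ := Presented.mkAlg_surjective a
  have h := Presented.mkAlg_rel (KleinRel.central (q := q)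
    (ζ := fun i : Fin (n + 1) => FreeStarAlgebra.of (KleinGen.zeta i))
    (ξ := FreeStarAlgebra.of KleinGen.xi) a)
  rwa [map_mul, map_mul] at h

/-- The images of the generators in `EvenSphere ⊗ OU1`: `ζ i ↦ z i ⊗ v` and `ξ ↦ 1 ⊗ v⁻²`. -/
def genImage (q : ℝ) (n : ℕ) : KleinGen n → EvenSphere q n ⊗[ℂ] OU1
  | .zeta i => Presented.gen i ⊗ₜ vpow 1
  | .xi => 1 ⊗ₜ vpow (-2)

/-- The homomorphism with `ζ i ↦ z i ⊗ v` and `ξ ↦ 1 ⊗ v⁻²`. -/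
def toTensor (q : ℝ) (n : ℕ) : KleinAlgebra q n →⋆ₐ[ℂ] EvenSphere q n ⊗[ℂ] OU1 :=
  Presented.lift (genImage q n) (fun a b h => by
    cases h with
    | sphere h =>
      have h' := h.map (FreeStarAlgebra.lift (genImage q n))
      simp only [FreeStarAlgebra.lift_of] at h'
      exact SphereRel.eq_of_tmul_vpow EvenSphere.rel h'
    | star_last =>
      rw [map_star, map_mul, FreeStarAlgebra.lift_of, FreeStarAlgebra.lift_of]
      simp only [genImage]
      rw [TensorProduct.star_tmul, star_vpow, EvenSphere.selfAdjoint,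
        Algebra.TensorProduct.tmul_mul_tmul, mul_one, vpow_mul]
      rfl
    | star_mul_self =>
      rw [map_mul, map_star, map_one, FreeStarAlgebra.lift_of]
      exact one_tmul_vpow_star_mul (-2)
    | mul_star_self =>
      rw [map_mul, map_star, map_one, FreeStarAlgebra.lift_of]
      exact one_tmul_vpow_mul_star (-2)
    | central a =>
      rw [map_mul, map_mul, FreeStarAlgebra.lift_of]
      exact one_tmul_vpow_comm (-2) _)

theorem toTensor_zeta (i : Fin (n + 1)) :
    toTensor q n (zeta i) = Presented.gen i ⊗ₜ vpow 1 := Presented.lift_gen ..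

theorem toTensor_xi : toTensor q n xi = 1 ⊗ₜ vpow (-2) := Presented.lift_gen ..

/-- The homomorphism with `z i ↦ ζ i * √ξ`. The element `ζ n * √ξ` is self-adjoint because
`(ζ n)* = ζ n * ξ`. -/
def ofEvenSphere (q : ℝ) (n : ℕ) :
    EvenSphere q n →⋆ₐ[ℂ] Matrix (Fin 2) (Fin 2) (KleinAlgebra q n) :=
  Presented.lift (fun i => Matrix.scalar (Fin 2) (zeta i) * sqrtMatrix xi) (fun a b h => by
    cases h with
    | sphere h =>
      have h' := h.map (FreeStarAlgebra.lift (fun i : Fin (n + 1) =>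
        Matrix.scalar (Fin 2) (zeta i : KleinAlgebra q n) * sqrtMatrix xi))
      simp only [FreeStarAlgebra.lift_of] at h'
      exact SphereRel.eq_of_mul_sqrtMatrix rel commute_xi xi_mul_star star_xi_mul h'
    | selfAdjoint =>
      rw [map_star, FreeStarAlgebra.lift_of, star_mul, star_scalar, star_zeta_last,
        ← (commute_xi _).eq, map_mul, ← sqrtMatrix_mul_self, ← mul_assoc, ← mul_assoc,
        star_mul_sqrtMatrix star_xi_mul, one_mul, (commute_sqrtMatrix commute_xi _).eq])

/-- The star-algebra isomorphism given by `z i ⊗ v ↦ ζ i` and `1 ⊗ v⁻² ↦ ξ`. -/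
theorem nonempty_evenProlongation_equiv (q : ℝ) (n : ℕ) :
    Nonempty (evenProlongation q n ≃⋆ₐ[ℂ] KleinAlgebra q n) := by
  obtain ⟨e, he⟩ := exists_equiv_cotensor (ρ := evenCoaction q n)
    (fun _ => Presented.lift_gen ..) (ζ := zeta) (ξ := xi)
    (fun S h1 h2 h3 h4 a => Presented.mem_of_gen_mem S
      (fun x => by cases x with | zeta i => exact h1 i | xi => exact h3)
      (fun x => by cases x with | zeta i => exact h2 i | xi => exact h4) a)
    commute_xi xi_mul_star star_xi_mul (toTensor q n).toAlgHom
    toTensor_zeta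
    (fun i => by
      change toTensor q n _ = _
      rw [map_star, toTensor_zeta, TensorProduct.star_tmul, star_vpow])
    toTensor_xi
    (by
      change toTensor q n _ = _
      rw [map_star, toTensor_xi, TensorProduct.star_tmul, star_vpow, star_one, neg_neg])
    (ofEvenSphere q n) (fun _ => Presented.lift_gen ..)
  refine ⟨(StarAlgEquiv.ofAlgEquiv e fun a => Subtype.ext ?_).symm⟩
  rw [he]
  refine (map_star (toTensor q n) a).trans ?_
  exact congrArg star (he a).symm

end KleinAlgebra

end QSphere

end

theorem proposition5p2 (q : ℝ) (hq0 : 0 < q) (hq1 : q < 1) :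
    (∀ n : ℕ, 1 ≤ n →
      Nonempty (QSphere.oddProlongation q n ≃ₐ[ℂ] QSphere.OddSphere q n ⊗[ℂ] QSphere.OU1)) ∧
    (∀ n : ℕ, 1 < n →
      Nonempty (QSphere.evenProlongation q n ≃⋆ₐ[ℂ] QSphere.KleinAlgebra q n)) :=
  ⟨fun n _ => QSphere.nonempty_oddProlongation_equiv q n,
    fun n _ => QSphere.KleinAlgebra.nonempty_evenProlongation_equiv q n⟩
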